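/- Let $\mathrm{elh}(\mathbb{C})$ be the set of entire functions $f$ with $f'(z)\neq 0$ for all $z\in\mathbb{C}$ and $f'(0)=1$. Call $f\in\mathrm{elh}(\mathbb{C})$ composite if $f=g\circ h$ for two entire functions $g,h$, neither of which is an automorphism $z\mapsto cz+d$ ($c\neq 0$) of $\mathbb{C}$. For an entire function $H$ put $h_H(z)=\int_0^z e^{H(t)}\,dt$. Let $f\in\mathrm{elh}(\mathbb{C})$. Then $f$ is composite if and only if there exist entire functions $H$ and $G$, with $H$ non-constant, such that one of the following holds: (1) $h_H(\mathbb{C})=\mathbb{C}$, $G$ is non-constant, and $$f(z)=f(0)+\int_0^{h_H(z)}e^{G(t)}\,dt\qquad\text{for all } z\in\mathbb{C};$$ (2) $h_H(\mathbb{C})=\mathbb{C}\setminus\{a\}$ for some $a\in\mathbb{C}$, and for some integer $N\geq 0$ $$f(z)=f(0)+\int_0^{h_H(z)}(t-a)^N e^{G(t)}\,dt\qquad\text{for all } z\in\mathbb{C},$$ where $G$ is non-constant if $N=0$. -/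

import Mathlib

open Set

noncomputable section

/-- The class `elh(ℂ)`: entire functions with nowhere vanishing derivative, normalized by
`f'(0) = 1`. (The value `f(0)` is not normalized.) -/
def elh : Set (ℂ → ℂ) :=
  {f | Differentiable ℂ f ∧ (∀ z, deriv f z ≠ 0) ∧ deriv f 0 = 1}

/-- `g` is a holomorphic automorphism of the complex plane, i.e. `g(z) = c z + d` with `c ≠ 0`. -/
def IsAutC (g : ℂ → ℂ) : Prop :=
  ∃ c d : ℂ, c ≠ 0 ∧ ∀ z, g z = c * z + d

/-- `f` is composite: `f = g ∘ h` with `g`, `h` entire, neither of them an automorphism of `ℂ`. -/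
def IsComposite (f : ℂ → ℂ) : Prop :=
  ∃ g h : ℂ → ℂ, Differentiable ℂ g ∧ Differentiable ℂ h ∧ ¬ IsAutC g ∧ ¬ IsAutC h ∧ f = g ∘ h

/-- `φ` is not a constant function. -/
def NonConst (φ : ℂ → ℂ) : Prop :=
  ¬ ∃ c : ℂ, ∀ z, φ z = c

/-- The complex line integral `∫₀ʷ φ(t) dt` along the segment from `0` to `w`
(for entire `φ` it does not depend on the path). -/
def segInt (φ : ℂ → ℂ) (w : ℂ) : ℂ :=
  ∫ s in (0 : ℝ)..1, φ ((s : ℂ) * w) * w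

/-- The function `h(z) = ∫₀ᶻ exp(H(t)) dt`. -/
def expInt (H : ℂ → ℂ) (z : ℂ) : ℂ :=
  segInt (fun t => Complex.exp (H t)) z

end

open Set

/-! If `f = g ∘ h`, the chain rule makes `h'` zero-free and `g'` zero-free on the image of `h`. An
affine change of variable turns `h` into `expInt H`, so `f` is `f 0` plus a primitive of some `φ`,
evaluated at `expInt H`, and `φ` has no zero on the image. By little Picard (`little_picard`) that
image omits at most one point `a`. Hence `φ` is `exp G`, or `(t - a) ^ N * exp G` if `a` is omitted.
The non-constancy conditions say that neither factor is affine, which also gives the converse.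

Little Picard follows from Bloch's theorem. If `F` omits `0` and `1`, then `F = exp (2πi cosh² v)`
with `v` entire, and `v` avoids a set that meets every disc of radius 5; so `v` is constant. -/

/-! ### Primitives and logarithms of entire functions -/

/-- Two entire functions with the same derivative differ by a constant. -/
theorem sub_eq_sub_of_hasDerivAt {f g φ : ℂ → ℂ} (hf : ∀ z, HasDerivAt f (φ z) z)
    (hg : ∀ z, HasDerivAt g (φ z) z) (z w : ℂ) : f z - f w = g z - g w := by
  have hd : ∀ z, HasDerivAt (fun z => f z - g z) 0 z := fun z => by
    have := (hf z).sub (hg z)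
    rw [sub_self] at this
    exact this
  have := is_const_of_deriv_eq_zero (fun z => (hd z).differentiableAt) (fun z => (hd z).deriv) z w
  linear_combination this

theorem eq_const_of_hasDerivAt_zero {f : ℂ → ℂ} (hf : ∀ z, HasDerivAt f 0 z) (z w : ℂ) :
    f z = f w :=
  is_const_of_deriv_eq_zero (fun z => (hf z).differentiableAt) (fun z => (hf z).deriv) z w

theorem exists_primitive {φ : ℂ → ℂ} (hφ : Differentiable ℂ φ) :
    ∃ P : ℂ → ℂ, ∀ z, HasDerivAt P (φ z) z := by
  obtain ⟨P, hP⟩ := hφ.isExactOn_univ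
  exact ⟨P, fun z => hP z (mem_univ z)⟩

theorem segInt_eq_sub {φ P : ℂ → ℂ} (hφ : Differentiable ℂ φ)
    (hP : ∀ z, HasDerivAt P (φ z) z) (w : ℂ) : segInt φ w = P w - P 0 := by
  have hd : ∀ s : ℝ, HasDerivAt (fun s : ℝ => P ((s : ℂ) * w)) (φ ((s : ℂ) * w) * w) s := by
    intro s
    have h1 : HasDerivAt (fun s : ℝ => (s : ℂ) * w) w s := by
      simpa using (Complex.ofRealCLM.hasDerivAt (x := s)).mul_const w
    exact (hP _).comp s h1
  have hc : Continuous fun s : ℝ => φ ((s : ℂ) * w) * w := by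
    have := hφ.continuous
    fun_prop
  have := intervalIntegral.integral_eq_sub_of_hasDerivAt (fun s _ => hd s)
    (hc.intervalIntegrable 0 1)
  simpa [segInt] using this

theorem hasDerivAt_segInt {φ : ℂ → ℂ} (hφ : Differentiable ℂ φ) (w : ℂ) :
    HasDerivAt (segInt φ) (φ w) w := by
  obtain ⟨P, hP⟩ := exists_primitive hφ
  rw [funext (segInt_eq_sub hφ hP)]
  exact (hP w).sub_const _

/-- A nowhere vanishing entire function has an entire logarithm. -/
theorem exists_entire_log {f : ℂ → ℂ} (hf : Differentiable ℂ f) (h0 : ∀ z, f z ≠ 0) :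
    ∃ L : ℂ → ℂ, Differentiable ℂ L ∧ ∀ z, f z = Complex.exp (L z) := by
  have hf' : Differentiable ℂ (deriv f) := fun z =>
    (hf.analyticAt z).deriv.differentiableAt
  obtain ⟨P, hP⟩ := exists_primitive (hf'.div hf h0)
  -- As `P' = f'/f`, this product is constant; a logarithm of its value at `0` corrects `P`.
  have hd : ∀ z, HasDerivAt (fun z => f z * Complex.exp (-P z)) 0 z := fun z => by
    convert! (hf z).hasDerivAt.mul (hP z).neg.cexp using 1
    have := h0 z
    simp only [Pi.div_apply]
    field_simp
    ring
  refine ⟨fun z => P z + Complex.log (f 0 * Complex.exp (-P 0)), fun z =>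
    (hP z).differentiableAt.add_const _, fun z => ?_⟩
  rw [Complex.exp_add, Complex.exp_log (mul_ne_zero (h0 0) (Complex.exp_ne_zero _)),
    ← eq_const_of_hasDerivAt_zero hd z 0, mul_left_comm, ← Complex.exp_add]
  simp

/-! ### Bloch's theorem -/

open Metric in
/-- If `‖f'‖` is at most twice its central value on a disc, the image of `f` contains a disc of
comparable size. -/
theorem ball_subset_range_of_norm_deriv_le {f : ℂ → ℂ} (hf : Differentiable ℂ f) {a : ℂ} {r : ℝ}
    (hr : 0 < r) (h0 : deriv f a ≠ 0) (hb : ∀ z ∈ ball a r, ‖deriv f z‖ ≤ 2 * ‖deriv f a‖) :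
    ball (f a) (r * ‖deriv f a‖ / 24) ⊆ range f := by
  have hf' : Differentiable ℂ (deriv f) := fun z => (hf.analyticAt z).deriv.differentiableAt
  set M := ‖deriv f a‖ with hM
  have hMpos : 0 < M := norm_pos_iff.mpr h0
  -- Schwarz lemma for `f' - f' a`, which is bounded by `3 * M` on the ball of radius `r`.
  have schwarz : ∀ z ∈ closedBall a (r / 6), ‖deriv f z - deriv f a‖ ≤ M / 2 := by
    intro z hz
    have hz' : dist z a ≤ r / 6 := hz
    have := Complex.dist_le_div_mul_dist_of_mapsTo_ball (R₁ := r) (R₂ := 3 * M) (c := a) (z := z)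
      hf'.differentiableOn (fun w hw => by
        rw [mem_closedBall, dist_eq_norm]
        have := norm_sub_le (deriv f w) (deriv f a)
        linarith [hb w hw]) (by rw [mem_ball]; linarith)
    rw [dist_eq_norm] at this
    refine this.trans ?_
    calc 3 * M / r * dist z a ≤ 3 * M / r * (r / 6) := by gcongr
      _ = M / 2 := by field_simp; norm_num
  have hlip : ∀ z ∈ closedBall a (r / 6),
      ‖(f z - deriv f a * z) - (f a - deriv f a * a)‖ ≤ M / 2 * ‖z - a‖ := by
    intro z hz
    refine (convex_closedBall a (r / 6)).norm_image_sub_le_of_norm_hasDerivWithin_le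
      (f := fun z => f z - deriv f a * z) (f' := fun z => deriv f z - deriv f a)
      (fun x _ => ?_) schwarz (mem_closedBall_self (by positivity)) hz
    have := (hf x).hasDerivAt.sub ((hasDerivAt_id x).const_mul (deriv f a))
    simp only [mul_one] at this
    exact this.hasDerivWithinAt
  -- The linear part has size `M * r / 6` here and the error is at most half of that. The
  -- quantitative open mapping theorem then loses a further factor 2, whence 24.
  have hsphere : ∀ z ∈ sphere a (r / 6), r * M / 12 ≤ ‖f z - f a‖ := by
    intro z hz
    have hza : ‖z - a‖ = r / 6 := by simpa [dist_eq_norm] using hz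
    have h1 := hlip z (sphere_subset_closedBall hz)
    have h2 : ‖deriv f a * (z - a)‖ = M * (r / 6) := by rw [norm_mul, hza]
    have h3 := norm_sub_le (f z - f a) ((f z - deriv f a * z) - (f a - deriv f a * a))
    rw [show f z - f a - ((f z - deriv f a * z) - (f a - deriv f a * a))
      = deriv f a * (z - a) by ring, h2] at h3
    rw [hza] at h1
    nlinarith
  have := DiffContOnCl.ball_subset_image_closedBall (hf.diffContOnCl (s := ball a (r / 6)))
    (by positivity) hsphere
    (((hf a).hasDerivAt.eventually_ne h0 (c := f a)).frequently.filter_mono nhdsWithin_le_nhds)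
  rw [show r * M / 24 = r * M / 12 / 2 by ring]
  exact this.trans (image_subset_range _ _)

open Metric in
/-- **Bloch's theorem** for entire functions: the image of a non-constant entire function contains
discs of arbitrarily large radius. -/
theorem exists_ball_subset_range {f : ℂ → ℂ} (hf : Differentiable ℂ f) {c : ℂ}
    (hc : deriv f c ≠ 0) (ρ : ℝ) : ∃ w, ball w ρ ⊆ range f := by
  have hf' : Differentiable ℂ (deriv f) := fun z => (hf.analyticAt z).deriv.differentiableAt
  have hpos : 0 < ‖deriv f c‖ := norm_pos_iff.mpr hc
  -- 48 = 2 · 24: the 24 of the previous lemma, and 2 for the halved radius below.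
  set R : ℝ := 48 * (|ρ| + 1) / ‖deriv f c‖ with hR
  have hRpos : 0 < R := by positivity
  -- Landau's trick: the weight is the distance to the boundary. It drops by at most half on the
  -- ball of half that distance around the maximum point, so `‖f'‖` at most doubles there.
  obtain ⟨a, ha, hmax⟩ := (isCompact_closedBall c R).exists_isMaxOn
    ⟨c, mem_closedBall_self hRpos.le⟩ (f := fun z => ‖deriv f z‖ * (R - dist z c)) (by
      have := hf'.continuous
      fun_prop)
  have hac := hmax (mem_closedBall_self hRpos.le)
  simp only [mem_ofPred_eq, dist_self, sub_zero] at hac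
  have hRc : ‖deriv f c‖ * R = 48 * (|ρ| + 1) := by rw [hR]; field_simp
  have hprod : 0 < ‖deriv f a‖ * (R - dist a c) := by
    refine lt_of_lt_of_le ?_ hac
    positivity
  have hda : 0 < R - dist a c := pos_of_mul_pos_right hprod (norm_nonneg _)
  have hfa : 0 < ‖deriv f a‖ := pos_of_mul_pos_left hprod hda.le
  have key := ball_subset_range_of_norm_deriv_le hf (a := a) (r := (R - dist a c) / 2)
    (by positivity) (norm_pos_iff.mp hfa) (fun z hz => by
      have hz' : dist z a < (R - dist a c) / 2 := hz
      have htri := dist_triangle z a c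
      have hm := hmax (show z ∈ closedBall c R by rw [mem_closedBall]; linarith)
      simp only [mem_ofPred_eq] at hm
      have : ‖deriv f z‖ * ((R - dist a c) / 2) ≤ ‖deriv f z‖ * (R - dist z c) := by
        gcongr; linarith
      by_contra! hlt
      nlinarith)
  refine ⟨f a, (ball_subset_ball ?_).trans key⟩
  have := le_abs_self ρ
  nlinarith

/-! ### Little Picard theorem -/

/-- The points `arsinh √m` have gaps at most 1: if `sinh² x < m + 1 = cosh² a`, then `sinh (a + 1) ≥
cosh a > sinh x`. -/
theorem exists_cosh_sq_eq_natCast_of_nonneg {x : ℝ} (hx : 0 ≤ x) :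
    ∃ (a : ℝ) (m : ℕ), |a - x| ≤ 1 ∧ Real.cosh a ^ 2 = m + 1 := by
  set m := ⌊Real.sinh x ^ 2⌋₊ with hm
  have hm1 : (m : ℝ) ≤ Real.sinh x ^ 2 := Nat.floor_le (sq_nonneg _)
  have hm2 : Real.sinh x ^ 2 < m + 1 := Nat.lt_floor_add_one _
  have hsx : 0 ≤ Real.sinh x := Real.sinh_nonneg_iff.mpr hx
  set a := Real.arsinh (Real.sqrt m) with ha
  have hsa : Real.sinh a = Real.sqrt m := Real.sinh_arsinh _
  have hca : Real.cosh a ^ 2 = m + 1 := by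
    rw [Real.cosh_sq, hsa, Real.sq_sqrt (Nat.cast_nonneg m)]
  refine ⟨a, m, ?_, hca⟩
  have h1 : a ≤ x := by
    rw [← Real.sinh_le_sinh, hsa]
    exact Real.sqrt_le_iff.mpr ⟨hsx, hm1⟩
  have h2 : x ≤ a + 1 := by
    rw [← Real.sinh_le_sinh, Real.sinh_add]
    have e1 : (1 : ℝ) ≤ Real.sinh 1 := Real.self_le_sinh_iff.mpr zero_le_one
    have e2 : 0 ≤ Real.sinh a * Real.cosh 1 :=
      mul_nonneg (hsa ▸ Real.sqrt_nonneg _) (Real.cosh_pos 1).le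
    have e3 := Real.cosh_pos a
    have e4 : Real.sinh x ≤ Real.cosh a := by
      apply le_of_lt
      apply lt_of_pow_lt_pow_left₀ 2 e3.le
      rwa [hca]
    nlinarith
  rw [abs_le]
  constructor <;> linarith

theorem exists_cosh_sq_eq_natCast (x : ℝ) :
    ∃ (a : ℝ) (m : ℕ), |a - x| ≤ 1 ∧ Real.cosh a ^ 2 = m + 1 := by
  rcases le_total 0 x with hx | hx
  · exact exists_cosh_sq_eq_natCast_of_nonneg hx
  · obtain ⟨a, m, h1, h2⟩ := exists_cosh_sq_eq_natCast_of_nonneg (neg_nonneg.mpr hx)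
    refine ⟨-a, m, ?_, by rwa [Real.cosh_neg]⟩
    rwa [← abs_neg, show -(-a - x) = a - -x by ring]

-- `cosh²` has period `πi`, so real solutions are translated by multiples of `πi`. The radius 5
-- exceeds `1 + π`.
open Metric in
theorem exists_mem_ball_cosh_sq_eq_natCast (w : ℂ) :
    ∃ z ∈ ball w 5, ∃ m : ℕ, Complex.cosh z ^ 2 = m + 1 := by
  obtain ⟨a, m, h1, h2⟩ := exists_cosh_sq_eq_natCast w.re
  set k : ℤ := ⌊w.im / Real.pi⌋ with hk
  have hpi := Real.pi_pos
  have hk1 : k * Real.pi ≤ w.im := (le_div_iff₀ hpi).mp (Int.floor_le _)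
  have hk2 : w.im < (k + 1) * Real.pi := (div_lt_iff₀ hpi).mp (Int.lt_floor_add_one _)
  refine ⟨a + (k * Real.pi : ℂ) * Complex.I, ?_, m, ?_⟩
  · rw [mem_ball, dist_eq_norm]
    refine (Complex.norm_le_abs_re_add_abs_im _).trans_lt ?_
    have him : |k * Real.pi - w.im| ≤ Real.pi := by
      rw [abs_le]; constructor <;> nlinarith
    have := Real.pi_lt_four
    simp
    linarith
  · have hs : Complex.sin (k * Real.pi) = 0 := Complex.sin_int_mul_pi k
    have hc : Complex.cos (k * Real.pi) ^ 2 = 1 := by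
      have := Complex.sin_sq_add_cos_sq (k * Real.pi)
      rw [hs] at this
      linear_combination this
    rw [Complex.cosh_add, Complex.cosh_mul_I, Complex.sinh_mul_I, hs]
    rw [show (Complex.cosh a * Complex.cos (k * Real.pi) + Complex.sinh a * (0 * Complex.I)) ^ 2
      = Complex.cosh a ^ 2 * Complex.cos (k * Real.pi) ^ 2 by ring, hc, mul_one]
    exact_mod_cast h2

/-- An entire function omitting `0` and `1` is constant. -/
theorem eq_const_of_omits_zero_one {F : ℂ → ℂ} (hF : Differentiable ℂ F) (h0 : ∀ z, F z ≠ 0)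
    (h1 : ∀ z, F z ≠ 1) (z w : ℂ) : F z = F w := by
  obtain ⟨L, hL, hFL⟩ := exists_entire_log hF h0
  have hpi : (2 * Real.pi * Complex.I : ℂ) ≠ 0 := Complex.two_pi_I_ne_zero
  set u : ℂ → ℂ := fun z => L z / (2 * Real.pi * Complex.I) with hu
  have hud : Differentiable ℂ u := hL.div_const _
  have hFu : ∀ z, F z = Complex.exp (2 * Real.pi * Complex.I * u z) := fun z => by
    rw [hFL, hu]; congr 1; field_simp
  have hun : ∀ z (n : ℤ), u z ≠ n := fun z n hn => by
    apply h1 z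
    rw [hFu, hn, mul_comm]
    exact Complex.exp_int_mul_two_pi_mul_I n
  obtain ⟨A, hA, huA⟩ := exists_entire_log hud (fun z => by simpa using hun z 0)
  obtain ⟨B, hB, huB⟩ := exists_entire_log (hud.sub_const 1)
    (fun z => by simpa [sub_eq_zero] using hun z 1)
  have hp : ∀ z, Complex.exp (A z / 2) ^ 2 = u z := fun z => by
    rw [huA, ← Complex.exp_nat_mul]; congr 1; push_cast; ring
  have hq : ∀ z, Complex.exp (B z / 2) ^ 2 = u z - 1 := fun z => by
    rw [huB, ← Complex.exp_nat_mul]; congr 1; push_cast; ring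
  -- With `p² = u` and `q² = u - 1`, the factors `p - q` and `p + q` are inverse to each other,
  -- hence `exp v` and `exp (-v)`, and `p = cosh v`.
  have hpq : ∀ z, (Complex.exp (A z / 2) - Complex.exp (B z / 2)) *
      (Complex.exp (A z / 2) + Complex.exp (B z / 2)) = 1 := fun z => by
    linear_combination hp z - hq z
  obtain ⟨v, hv, hpv⟩ := exists_entire_log
    (f := fun z => Complex.exp (A z / 2) - Complex.exp (B z / 2)) (by fun_prop)
    (fun z h => by simpa [h] using hpq z)
  have hpv' : ∀ z, Complex.exp (A z / 2) + Complex.exp (B z / 2) = Complex.exp (-v z) := fun z => by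
    rw [Complex.exp_neg, ← hpv]
    exact eq_inv_of_mul_eq_one_right (hpq z)
  have huv : ∀ z, u z = Complex.cosh (v z) ^ 2 := fun z => by
    rw [← hp, Complex.cosh, ← hpv', ← hpv]; ring
  have hv' : ∀ z, deriv v z = 0 := by
    by_contra! hne
    obtain ⟨c, hc⟩ := hne
    obtain ⟨b, hb⟩ := exists_ball_subset_range hv hc 5
    obtain ⟨y, hy, m, hm⟩ := exists_mem_ball_cosh_sq_eq_natCast b
    obtain ⟨x, rfl⟩ := hb hy
    apply hun x (m + 1)
    rw [huv, hm]
    push_cast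
    rfl
  rw [hFu, hFu, huv, huv, is_const_of_deriv_eq_zero hv hv' z w]

/-- **Little Picard theorem**: an entire function omitting two values is constant. -/
theorem little_picard {f : ℂ → ℂ} (hf : Differentiable ℂ f) {a b : ℂ} (hab : a ≠ b)
    (ha : a ∉ range f) (hb : b ∉ range f) (z w : ℂ) : f z = f w := by
  have hba : b - a ≠ 0 := sub_ne_zero.mpr hab.symm
  have := eq_const_of_omits_zero_one (F := fun z => (f z - a) / (b - a)) (by fun_prop)
    (fun z h => ha ⟨z, by simpa [hba, sub_eq_zero] using h⟩)
    (fun z h => hb ⟨z, by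
      rw [div_eq_one_iff_eq hba] at h
      linear_combination h⟩) z w
  rw [div_left_inj' hba] at this
  linear_combination this

/-! ### Entire functions with at most one zero -/

/-- A nonzero entire function without zeros off `a` is `(z - a) ^ N * exp (G z)`. -/
theorem exists_eq_pow_mul_exp {k : ℂ → ℂ} (hk : Differentiable ℂ k) {a : ℂ}
    (h0 : ∀ z, z ≠ a → k z ≠ 0) :
    ∃ (N : ℕ) (G : ℂ → ℂ), Differentiable ℂ G ∧
      ∀ z, k z = (z - a) ^ N * Complex.exp (G z) := by
  obtain ⟨p, hp⟩ := hk.analyticAt a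
  have hp0 : p ≠ 0 := by
    rw [Ne, ← hp.locally_zero_iff]
    intro h
    have hne : ∀ᶠ z in nhdsWithin a {a}ᶜ, k z ≠ 0 :=
      eventually_mem_nhdsWithin.mono fun z hz => h0 z hz
    obtain ⟨z, hz⟩ := (hne.and (h.filter_mono nhdsWithin_le_nhds)).exists
    exact hz.1 hz.2
  -- Each `dslope` divides out one factor `z - a`; after `p.order` of them no zero is left.
  have hdiff : ∀ n, Differentiable ℂ ((Function.swap dslope a)^[n] k) := by
    intro n
    induction n with
    | zero => exact hk
    | succ n ih =>
      rw [Function.iterate_succ_apply']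
      exact differentiableOn_univ.mp
        ((Complex.differentiableOn_dslope Filter.univ_mem).mpr ih.differentiableOn)
  obtain ⟨G, hG, h⟩ := exists_entire_log (hdiff p.order) (fun z hz => by
    rcases eq_or_ne z a with rfl | hza
    · exact hp.iterate_dslope_fslope_ne_zero hp0 hz
    · apply h0 z hza
      rw [hp.eq_pow_order_mul_iterate_dslope z, hz, smul_zero])
  refine ⟨p.order, G, hG, fun z => ?_⟩
  rw [hp.eq_pow_order_mul_iterate_dslope z, h, smul_eq_mul]

/-! ### Composite functions -/

theorem hasDerivAt_expInt {H : ℂ → ℂ} (hH : Differentiable ℂ H) (z : ℂ) :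
    HasDerivAt (expInt H) (Complex.exp (H z)) z :=
  hasDerivAt_segInt hH.cexp z

theorem eq_of_exp_eq_const {H : ℂ → ℂ} {c : ℂ} (hH : Differentiable ℂ H)
    (hc : ∀ z, Complex.exp (H z) = c) (z w : ℂ) : H z = H w := by
  refine eq_const_of_hasDerivAt_zero (fun z => ?_) z w
  have h1 := (hH z).hasDerivAt.cexp
  rw [show (fun z => Complex.exp (H z)) = fun _ => c from funext hc] at h1
  have h2 := h1.unique (hasDerivAt_const z c)
  have h3 := (mul_eq_zero.mp h2).resolve_left (Complex.exp_ne_zero _)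
  simpa [h3] using (hH z).hasDerivAt

theorem exp_not_const {G : ℂ → ℂ} (hG : Differentiable ℂ G) (hGn : NonConst G) (c : ℂ) :
    ¬ ∀ z, Complex.exp (G z) = c := fun h =>
  hGn ⟨G 0, fun z => eq_of_exp_eq_const hG h z 0⟩

theorem IsAutC.exists_derivative_eq {g φ : ℂ → ℂ} (hg : IsAutC g)
    (hφ : ∀ z, HasDerivAt g (φ z) z) : ∃ c, c ≠ 0 ∧ ∀ z, φ z = c := by
  obtain ⟨c, d, hc, h⟩ := hg
  refine ⟨c, hc, fun z => (hφ z).unique ?_⟩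
  rw [funext h]
  simpa using ((hasDerivAt_id z).const_mul c).add_const d

theorem isAutC_of_hasDerivAt {g : ℂ → ℂ} {c : ℂ} (hc : c ≠ 0)
    (hg : ∀ z, HasDerivAt g c z) : IsAutC g := by
  refine ⟨c, g 0, hc, fun z => ?_⟩
  have := sub_eq_sub_of_hasDerivAt hg (g := fun z => c * z)
    (fun z => by simpa using (hasDerivAt_id z).const_mul c) z 0
  linear_combination this

theorem not_isAutC_of_hasDerivAt_exp {g G : ℂ → ℂ} (hG : Differentiable ℂ G) (hGn : NonConst G)
    (hg : ∀ z, HasDerivAt g (Complex.exp (G z)) z) : ¬ IsAutC g := fun h => by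
  obtain ⟨c, -, hc⟩ := h.exists_derivative_eq hg
  exact exp_not_const hG hGn c hc

theorem isComposite_of_eq_segInt {f H φ : ℂ → ℂ} (hH : Differentiable ℂ H) (hHn : NonConst H)
    (hφ : Differentiable ℂ φ) (hφc : ∀ c, c ≠ 0 → ¬ ∀ z, φ z = c)
    (hf : ∀ z, f z = f 0 + segInt φ (expInt H z)) : IsComposite f := by
  have hg : ∀ w, HasDerivAt (fun w => f 0 + segInt φ w) (φ w) w := fun w =>
    (hasDerivAt_segInt hφ w).const_add _
  refine ⟨fun w => f 0 + segInt φ w, expInt H, fun w => (hg w).differentiableAt,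
    fun z => (hasDerivAt_expInt hH z).differentiableAt, fun h => ?_,
    not_isAutC_of_hasDerivAt_exp hH hHn (hasDerivAt_expInt hH), funext hf⟩
  obtain ⟨c, hc, h⟩ := h.exists_derivative_eq hg
  exact hφc c hc h

/-- A composite `f ∈ elh` is `f 0 + segInt φ ∘ expInt H`, where `φ` has no zeros on the image of
`expInt H`. -/
theorem IsComposite.exists_eq_segInt {f : ℂ → ℂ} (hf : f ∈ elh) (hfc : IsComposite f) :
    ∃ H φ : ℂ → ℂ, Differentiable ℂ H ∧ NonConst H ∧ Differentiable ℂ φ ∧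
      (∀ z, φ (expInt H z) ≠ 0) ∧ (∀ c, c ≠ 0 → ¬ ∀ z, φ z = c) ∧
      ∀ z, f z = f 0 + segInt φ (expInt H z) := by
  obtain ⟨g, h, hg, hh, hga, hha, rfl⟩ := hfc
  obtain ⟨-, hne, -⟩ := hf
  have hg' : Differentiable ℂ (deriv g) := fun z => (hg.analyticAt z).deriv.differentiableAt
  have hh' : Differentiable ℂ (deriv h) := fun z => (hh.analyticAt z).deriv.differentiableAt
  have hchain : ∀ z, deriv g (h z) * deriv h z ≠ 0 := fun z => by
    rw [← deriv_comp z (hg _) (hh z)]; exact hne z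
  have hhne : ∀ z, deriv h z ≠ 0 := fun z => right_ne_zero_of_mul (hchain z)
  set c := deriv h 0 with hc
  have hc0 : c ≠ 0 := hhne 0
  obtain ⟨H, hH, hHe⟩ := exists_entire_log (hh'.div_const c)
    (fun z => div_ne_zero (hhne z) hc0)
  have hexp : ∀ z, c * expInt H z + h 0 = h z := fun z => by
    have hz : expInt H 0 = 0 := by simp [expInt, segInt]
    have := sub_eq_sub_of_hasDerivAt (f := h) (g := fun z => c * expInt H z) (φ := deriv h)
      (fun z => (hh z).hasDerivAt) (fun z => by
        convert! (hasDerivAt_expInt hH z).const_mul c using 1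
        rw [← hHe]; field_simp) z 0
    rw [hz] at this
    linear_combination -this
  -- Derivative of `w ↦ g (c * w + h 0)`: the affine normalisation of `h` is absorbed into the outer
  -- factor.
  have hφ : Differentiable ℂ fun w => c * deriv g (c * w + h 0) := by fun_prop
  refine ⟨H, fun w => c * deriv g (c * w + h 0), hH, fun ⟨d, hd⟩ => hha ?_, hφ, fun z => ?_,
    fun d hd hall => hga ?_, fun z => ?_⟩
  · refine isAutC_of_hasDerivAt hc0 fun z => ?_
    have h1 : deriv h z = c := by
      have e1 := hHe z
      rw [hd z, ← hd 0, ← hHe 0, ← hc, div_self hc0, div_eq_one_iff_eq hc0] at e1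
      exact e1
    exact h1 ▸ (hh z).hasDerivAt
  · beta_reduce
    rw [hexp]
    exact mul_ne_zero hc0 (left_ne_zero_of_mul (hchain z))
  · refine isAutC_of_hasDerivAt (div_ne_zero hd hc0) fun z => ?_
    have h1 : deriv g z = d / c := by
      have := hall ((z - h 0) / c)
      beta_reduce at this
      rw [mul_div_cancel₀ _ hc0, sub_add_cancel] at this
      rw [← this]; field_simp
    exact h1 ▸ (hg z).hasDerivAt
  · have hP : ∀ w, HasDerivAt (fun w => g (c * w + h 0)) (c * deriv g (c * w + h 0)) w := fun w => by
      have h1 : HasDerivAt (fun w => c * w + h 0) c w := by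
        simpa using ((hasDerivAt_id w).const_mul c).add_const (h 0)
      rw [mul_comm]
      exact (hg (c * w + h 0)).hasDerivAt.comp w h1
    rw [segInt_eq_sub hφ hP, hexp]
    simp

/-- The derivative is an exponential, so `expInt H` is not constant and little Picard applies. This
yields the dichotomy between the two cases. -/
theorem eq_of_notMem_range_expInt {H : ℂ → ℂ} (hH : Differentiable ℂ H) {a b : ℂ}
    (ha : a ∉ range (expInt H)) (hb : b ∉ range (expInt H)) : a = b := by
  by_contra hab
  have hconst := little_picard (fun z => (hasDerivAt_expInt hH z).differentiableAt) hab ha hb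
  have h1 := hasDerivAt_expInt hH 0
  rw [show expInt H = fun _ => expInt H 0 from funext fun z => hconst z 0] at h1
  exact Complex.exp_ne_zero _ (h1.unique (hasDerivAt_const _ _))

theorem proposition7 (f : ℂ → ℂ) (hf : f ∈ elh) :
    IsComposite f ↔
      ∃ H G : ℂ → ℂ, Differentiable ℂ H ∧ Differentiable ℂ G ∧ NonConst H ∧
        ((Set.range (expInt H) = Set.univ ∧ NonConst G ∧
            ∀ z, f z = f 0 + segInt (fun t => Complex.exp (G t)) (expInt H z)) ∨
          (∃ (a : ℂ) (N : ℕ), Set.range (expInt H) = {a}ᶜ ∧ (N = 0 → NonConst G) ∧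
            ∀ z, f z = f 0 + segInt (fun t => (t - a) ^ N * Complex.exp (G t)) (expInt H z))) := by
  constructor
  · intro hfc
    obtain ⟨H, φ, hH, hHn, hφ, hφ0, hφc, hfφ⟩ := hfc.exists_eq_segInt hf
    by_cases hr : range (expInt H) = univ
    · obtain ⟨G, hG, hGe⟩ := exists_entire_log hφ (fun w => by
        obtain ⟨z, rfl⟩ := hr.symm ▸ mem_univ w
        exact hφ0 z)
      obtain rfl : φ = fun t => Complex.exp (G t) := funext hGe
      refine ⟨H, G, hH, hG, hHn, Or.inl ⟨hr, ?_, hfφ⟩⟩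
      rintro ⟨c, hc⟩
      exact hφc (Complex.exp c) (Complex.exp_ne_zero c) fun z => by simp only [hc]
    · obtain ⟨a, ha⟩ := (ne_univ_iff_exists_notMem _).mp hr
      have hra : range (expInt H) = {a}ᶜ := by
        ext b
        rw [mem_compl_singleton_iff]
        exact ⟨fun hb h => ha (h ▸ hb), fun hb => by
          by_contra hb'
          exact hb (eq_of_notMem_range_expInt hH hb' ha)⟩
      obtain ⟨N, G, hG, hGe⟩ := exists_eq_pow_mul_exp hφ (a := a) (fun w hw => by
        obtain ⟨z, rfl⟩ : w ∈ range (expInt H) := hra ▸ hw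
        exact hφ0 z)
      obtain rfl : φ = fun t => (t - a) ^ N * Complex.exp (G t) := funext hGe
      refine ⟨H, G, hH, hG, hHn, Or.inr ⟨a, N, hra, ?_, hfφ⟩⟩
      rintro rfl ⟨c, hc⟩
      exact hφc (Complex.exp c) (Complex.exp_ne_zero c) fun z => by simp [hc]
  · rintro ⟨H, G, hH, hG, hHn, ⟨-, hGn, hfG⟩ | ⟨a, N, -, hN, hfG⟩⟩
    · exact isComposite_of_eq_segInt hH hHn hG.cexp (fun c _ => exp_not_const hG hGn c) hfG
    · refine isComposite_of_eq_segInt hH hHn (by fun_prop) (fun c hc hall => ?_) hfG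
      rcases eq_or_ne N 0 with rfl | hN0
      · exact exp_not_const hG (hN rfl) c (by simpa using hall)
      -- For `N ≠ 0` the integrand vanishes at `a`, so if constant it would be `0`.
      · apply hc
        rw [← hall a, sub_self, zero_pow hN0, zero_mul]
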